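/- All topological groups and all semigroups with a topology are assumed to be Hausdorff. A topological semigroup is a semigroup with a topology for which the multiplication $S\times S\to S$ is continuous; a powertopological semigroup is a semigroup with a topology for which the multiplication is separately continuous and, for every $n\ge 1$, the power map $x\mapsto x^n$ is continuous. A topological group $X$ is called $\mathsf{e}{:}\mathsf{TS}$-closed (resp. $\mathsf{e}{:}\mathsf{pTS}$-closed) if for every Hausdorff topological (resp. powertopological) semigroup $Y$ and every semigroup homomorphism $f:X\to Y$ that is a topological embedding, the image $f(X)$ is closed in $Y$. The group $X$ is Weil-complete if it is complete in its left uniformity, generated by the entourages $\{(x,y):y\in xU\}$ (equivalently, in its right uniformity, generated by the entourages $\{(x,y):y\in Ux\}$), and it is complete if it is complete in its two-sided uniformity, generated by the entourages $\{(x,y):y\in xU\cap Ux\}$, where $U$ runs over the neighborhoods of the unit. The group $X$ has compact exponent if for some integer $n\ge 1$ the set $\{x^n:x\in X\}$ has compact closure in $X$. **Theorem.** Let $X$ be a Hausdorff topological group that is nilpotent as an abstract group. The following conditions are equivalent: 1. $X$ is $\mathsf{e}{:}\mathsf{TS}$-closed; 2. $X$ is $\mathsf{e}{:}\mathsf{pTS}$-closed;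 3. $X$ is Weil-complete and has compact exponent; 4. $X$ is complete and has compact exponent. -/

import Mathlib

open Set Topology

universe u v

/-- `semigroupPow x n` is the power `x ^ (n + 1)` of an element of a semigroup (which need not have
a unit); so `n = 0, 1, 2, …` gives exactly the powers with positive exponents. -/
def semigroupPow {S : Type*} [Semigroup S] (x : S) : ℕ → S
  | 0 => x
  | n + 1 => semigroupPow x n * x

theorem semigroupPow_eq_pow {M : Type*} [Monoid M] (x : M) (n : ℕ) :
    semigroupPow x n = x ^ (n + 1) := by
  induction n with
  | zero => simp [semigroupPow]
  | succ n ih => rw [semigroupPow, ih, pow_succ x (n + 1)]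

/-- A powertopological semigroup: the multiplication is separately continuous, and all power maps
with positive exponents are continuous. -/
class IsPowertopologicalSemigroup (S : Type*) [TopologicalSpace S] [Semigroup S] : Prop
    extends SeparatelyContinuousMul S where
  continuous_semigroupPow : ∀ n : ℕ, Continuous fun x : S => semigroupPow x n

/-- `X` is `e:TS`-closed: its image is closed under every isomorphic topological embedding into a
Hausdorff topological semigroup. -/
def IsETSClosed (X : Type u) [TopologicalSpace X] [Semigroup X] : Prop :=
  ∀ (Y : Type v) [TopologicalSpace Y] [Semigroup Y] [ContinuousMul Y] [T2Space Y]
    (f : X →ₙ* Y), IsEmbedding f → IsClosed (range f)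

/-- `X` is `e:pTS`-closed: its image is closed under every isomorphic topological embedding into a
Hausdorff powertopological semigroup. -/
def IsEpTSClosed (X : Type u) [TopologicalSpace X] [Semigroup X] : Prop :=
  ∀ (Y : Type v) [TopologicalSpace Y] [Semigroup Y] [IsPowertopologicalSemigroup Y] [T2Space Y]
    (f : X →ₙ* Y), IsEmbedding f → IsClosed (range f)

/-- The two-sided uniformity, generated by the entourages `{(x, y) | y ∈ x U ∩ U x}` for
neighborhoods `U` of the unit: the coarsest uniformity finer than the left and the right one. -/
@[reducible]
def twoSidedUniformSpace (X : Type*) [TopologicalSpace X] [Group X] [IsTopologicalGroup X] :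
    UniformSpace X :=
  IsTopologicalGroup.leftUniformSpace X ⊓ IsTopologicalGroup.rightUniformSpace X

/-- A topological group is complete if it is complete in its two-sided uniformity. -/
def IsCompleteGroup (X : Type*) [TopologicalSpace X] [Group X] [IsTopologicalGroup X] : Prop :=
  @CompleteSpace X (twoSidedUniformSpace X)

/-- A topological group is Weil-complete if it is complete in its left uniformity
(equivalently, through the inversion, in its right uniformity). -/
def IsWeilComplete (X : Type*) [TopologicalSpace X] [Group X] [IsTopologicalGroup X] : Prop :=
  @CompleteSpace X (IsTopologicalGroup.leftUniformSpace X)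

/-- `X` has compact exponent: for some positive `n`, the set of all `n`-th powers has compact
closure. -/
def HasCompactExponent (X : Type*) [TopologicalSpace X] [Group X] : Prop :=
  ∃ n : ℕ, 1 ≤ n ∧ IsCompact (closure (range fun x : X => x ^ n))

/-!
The implication from `e:pTS`-closedness to `e:TS`-closedness is clear, since a topological semigroup
is powertopological. The other implications are as follows.

*Compact exponent makes completeness pass to closedness.* Suppose that `x ^ n` stays in a compact
set. Along a left Cauchy filter, `x ^ n` then converges, so `x⁻¹ = x ^ (n - 1) * (x ^ n)⁻¹` is left
Cauchy as well; hence completeness and Weil-completeness agree (`IsCompleteGroup.isWeilComplete`).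
If the group lies in a Hausdorff powertopological semigroup and `y` is in its closure, then `y ^ n`
is in the group, so `y` is invertible, and the same formula for inverses shows that the elements of
the group near `y` form a left Cauchy filter. Its limit in the group is `y`
(`IsWeilComplete.isEpTSClosed`).

*Closedness implies Weil-completeness.* The completion in the left uniformity is a topological
semigroup, because products of left Cauchy filters are left Cauchy (`IsETSClosed.isWeilComplete`).

*Closedness implies compact exponent for nilpotent groups.* Let `G` be a Hausdorff quotient of the
group `X`, and suppose that for no `n ≥ 1` the `n`-th powers of central elements of `G` are totally
bounded. A theorem of Neumann type (`exists_notMem_mul_of_forall_notMem_mul_inv`) yields central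
elements `a 0, a 1, …` such that different words of bounded length in distant terms stay uniformly apart
(`exists_seq_wordProd_apart`). On `G × ℕ` there is then a Hausdorff semigroup topology in which
`(a i, 0)` tends to `(1, 1)` (`LevelSemigroup`). Replacing the level `0` by `X` gives a Hausdorff
topological semigroup in which `X` is open and not closed (`Adjunction`). So in an `e:TS`-closed
group some powers of the central elements of each Hausdorff quotient are totally bounded. If the
`m`-th powers of `G` are totally bounded modulo the center, and the `n`-th powers of central
elements are totally bounded, then the `m * n`-th powers of `G` are totally bounded
(`leftTotallyBounded_range_pow_mul`), and an induction on the nilpotency class finishes the proof.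
-/

open Filter
open scoped Pointwise IsMulCommutative

/-! ### Coverings by translates and words in central sequences -/

/-- A set `A` in a topological group is left totally bounded if it is covered by finitely many left
translates of each neighborhood of the unit. -/
def LeftTotallyBounded {G : Type*} [TopologicalSpace G] [Group G] (A : Set G) : Prop :=
  ∀ U ∈ 𝓝 (1 : G), ∃ F : Set G, F.Finite ∧ A ⊆ F * U

/-- A version for sets of B. H. Neumann's theorem on coverings of a group by cosets: if no
`C i * (C i)⁻¹` has finitely many left translates that cover the group, then the group is not
covered by finitely many left translates of the sets `C i`. -/
theorem exists_notMem_mul_of_forall_notMem_mul_inv {G ι : Type*} [Group G] (C : ι → Set G)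
    (I : Finset ι)
    (hC : ∀ i ∈ I, ∀ F : Set G, F.Finite → ∃ x, x ∉ F * (C i * (C i)⁻¹))
    (F : ι → Set G) (hF : ∀ i ∈ I, (F i).Finite) : ∃ x, ∀ i ∈ I, x ∉ F i * C i := by
  classical
  induction I using Finset.induction_on generalizing F with
  | empty => exact ⟨1, by simp⟩
  | insert i I hi ih =>
    obtain ⟨g, hg⟩ := hC i (Finset.mem_insert_self i I) (F i) (hF i (Finset.mem_insert_self i I))
    obtain ⟨x, hx⟩ := ih (fun j hj => hC j (Finset.mem_insert_of_mem hj))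
      (fun j => F j ∪ F i * {g⁻¹} * F j) (fun j hj => by
        have h1 := hF j (Finset.mem_insert_of_mem hj)
        have h2 := hF i (Finset.mem_insert_self i I)
        exact h1.union ((h2.mul (Set.finite_singleton _)).mul h1))
    by_cases hxi : x ∈ F i * C i
    · -- `g * C i` is disjoint from `F i * C i`, so a translate of `x` does the job
      obtain ⟨f, hf, c, hc, rfl⟩ := hxi
      refine ⟨g * c, fun j hj => ?_⟩
      rcases Finset.mem_insert.1 hj with rfl | hj
      · rintro ⟨f', hf', c', hc', h⟩
        refine hg ⟨f', hf', c' * c⁻¹, ⟨c', hc', c⁻¹, Set.inv_mem_inv.2 hc, rfl⟩, ?_⟩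
        simp only at h ⊢
        rw [← mul_assoc, h, mul_inv_cancel_right]
      · rintro ⟨f', hf', c', hc', h⟩
        refine hx j hj ⟨f * g⁻¹ * f', Or.inr ⟨f * g⁻¹, ⟨f, hf, g⁻¹, rfl, rfl⟩, f', hf', rfl⟩,
          c', hc', ?_⟩
        simp only at h ⊢
        rw [mul_assoc, h, mul_assoc, inv_mul_cancel_left]
    · refine ⟨x, fun j hj => ?_⟩
      rcases Finset.mem_insert.1 hj with rfl | hj
      · exact hxi
      · exact fun h => hx j hj (Set.mul_subset_mul_right Set.subset_union_left h)

/-- Dependent choice of a sequence, each term of which is suitably related to the tuple of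
the earlier ones. -/
theorem exists_seq_of_forall_initial {α : Type*} (R : ∀ i : ℕ, (Fin i → α) → α → Prop)
    (h : ∀ i f, ∃ y, R i f y) : ∃ a : ℕ → α, ∀ i, R i (fun j => a j) (a i) := by
  choose g hg using h
  let a : ℕ → α := WellFounded.fix Nat.lt_wfRel.wf fun i f => g i fun j => f j j.2
  refine ⟨a, fun i => ?_⟩
  have : a i = g i fun j => a j := WellFounded.fix_eq _ _ _
  rw [this]
  exact hg _ _

section Comm

variable {Z : Type*} [CommGroup Z]

/-- The product of the terms `a i` of a sequence, `i` running over a multiset of indices. -/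
def wordProd (a : ℕ → Z) (w : Multiset ℕ) : Z := (w.map a).prod

theorem wordProd_add (a : ℕ → Z) (w w' : Multiset ℕ) :
    wordProd a (w + w') = wordProd a w * wordProd a w' := by
  simp [wordProd]

@[simp] theorem wordProd_zero (a : ℕ → Z) : wordProd a 0 = 1 := by simp [wordProd]

@[simp] theorem wordProd_singleton (a : ℕ → Z) (i : ℕ) : wordProd a {i} = a i := by
  simp [wordProd]

theorem wordProd_eq_prod_range (a : ℕ → Z) (w : Multiset ℕ) (N : ℕ) (hN : ∀ i ∈ w, i < N) :
    wordProd a w = ∏ j ∈ Finset.range N, a j ^ w.count j := by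
  rw [wordProd, Finset.prod_multiset_map_count]
  refine Finset.prod_subset (fun i hi => Finset.mem_range.2 (hN i (Multiset.mem_toFinset.1 hi)))
    fun i _ hi => ?_
  rw [Multiset.count_eq_zero.2 (fun h => hi (Multiset.mem_toFinset.2 h)), pow_zero]

/-- The quotient of the products of two different words is `a i ^ n` times a product of powers
of earlier terms; here `i` is the largest index with different multiplicities in the two words. -/
theorem exists_wordProd_div_eq (a : ℕ → Z) (w w' : Multiset ℕ) (hne : w ≠ w') :
    ∃ i, w.count i ≠ w'.count i ∧ wordProd a w / wordProd a w' =
      a i ^ ((w.count i : ℤ) - w'.count i) *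
        ∏ j : Fin i, a j ^ ((w.count (j : ℕ) : ℤ) - w'.count (j : ℕ)) := by
  obtain ⟨N, hN⟩ : ∃ N, ∀ i ∈ w + w', i < N :=
    ⟨(w + w').sup + 1, fun i hi => Nat.lt_succ_of_le (Multiset.le_sup hi)⟩
  have key : ∀ M, (∀ i, M ≤ i → w.count i = w'.count i) →
      ∃ i, i < M ∧ w.count i ≠ w'.count i ∧ ∀ j, i < j → w.count j = w'.count j := by
    intro M
    induction M with
    | zero => exact fun h => (hne (Multiset.ext.2 fun i => h i (Nat.zero_le i))).elim
    | succ M ih =>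
      intro h
      by_cases hM : w.count M = w'.count M
      · obtain ⟨i, hi, h'⟩ := ih fun i hi => by
          rcases hi.eq_or_lt with rfl | hi
          · exact hM
          · exact h i hi
        exact ⟨i, hi.trans (Nat.lt_succ_self M), h'⟩
      · exact ⟨M, Nat.lt_succ_self M, hM, fun j hj => h j hj⟩
  obtain ⟨i, hiN, hi, hj⟩ := key N fun i hi => by
    rw [Multiset.count_eq_zero.2, Multiset.count_eq_zero.2] <;>
      exact fun h => absurd (hN i (by simp [h])) (not_lt.2 hi)
  refine ⟨i, hi, ?_⟩
  rw [wordProd_eq_prod_range a w N fun i hi => hN i (by simp [hi]),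
    wordProd_eq_prod_range a w' N fun i hi => hN i (by simp [hi]), ← Finset.prod_div_distrib,
    ← Finset.prod_range (fun j => a j ^ ((w.count j : ℤ) - w'.count j)), mul_comm,
    ← Finset.prod_range_succ (fun j => a j ^ ((w.count j : ℤ) - w'.count j))]
  have hf : ∀ j, a j ^ w.count j / a j ^ w'.count j = a j ^ ((w.count j : ℤ) - w'.count j) :=
    fun j => by rw [zpow_sub, zpow_natCast, zpow_natCast, div_eq_mul_inv]
  simp only [hf]
  refine (Finset.prod_subset (Finset.range_subset_range.2 hiN) fun j _ h => ?_).symm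
  rw [hj j (by simpa using h), sub_self, zpow_zero]

variable [TopologicalSpace Z] [IsTopologicalGroup Z]

/-- If no set of `n`-th powers, `n ≥ 1`, of an abelian topological group is totally bounded, then
there is a sequence such that the products of two different words of bounded length in its distant
terms are uniformly apart. -/
theorem exists_seq_wordProd_apart
    (h : ∀ n : ℕ, 1 ≤ n → ¬ LeftTotallyBounded (range fun z : Z => z ^ n)) :
    ∃ a : ℕ → Z, ∀ K : ℕ, ∃ W ∈ 𝓝 (1 : Z), ∀ w w' : Multiset ℕ, w ≠ w' → w.card ≤ K → w'.card ≤ K →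
      (∀ i ∈ w, K ≤ i) → (∀ i ∈ w', K ≤ i) → wordProd a w / wordProd a w' ∉ W := by
  have h1 : ∀ n : ℕ, ∃ U ∈ 𝓝 (1 : Z), 1 ≤ n → ∀ F : Set Z, F.Finite → ∃ z : Z, z ^ n ∉ F * U := by
    intro n
    by_cases hn : 1 ≤ n
    · have := h n hn
      simp only [LeftTotallyBounded] at this
      push Not at this
      obtain ⟨U, hU, hU'⟩ := this
      refine ⟨U, hU, fun _ F hF => ?_⟩
      obtain ⟨_, ⟨z, rfl⟩, hz⟩ := Set.not_subset.1 (hU' F hF)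
      exact ⟨z, hz⟩
    · exact ⟨univ, univ_mem, fun h => (hn h).elim⟩
  choose U hU hUF using h1
  have h2 : ∀ n, ∃ V ∈ 𝓝 (1 : Z), V⁻¹ = V ∧ (V * V) * (V * V) ⊆ U n := by
    intro n
    obtain ⟨V, hV, hVo, hVi, hVV⟩ := exists_closed_nhds_one_inv_eq_mul_subset (hU n)
    obtain ⟨V', hV', hVo', hVi', hVV'⟩ := exists_closed_nhds_one_inv_eq_mul_subset hV
    exact ⟨V', hV', hVi', (Set.mul_subset_mul hVV' hVV').trans hVV⟩
  choose V hV hVi hVU using h2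
  -- a new term avoids any finite set of translates of the neighborhoods `V n`
  have h3 : ∀ (i : ℕ) (F : Set Z), F.Finite →
      ∃ y : Z, ∀ n ∈ Finset.Icc 1 i, ∀ f ∈ F, y ^ n * f ∉ V n := by
    intro i F hF
    let C : ℕ → Set Z := fun n => {z | z ^ n ∈ V n * V n}
    have hE : ∀ n : ℕ, ∃ E : Set Z, E.Finite ∧ ∀ y : Z, ∀ f ∈ F, y ^ n * f ∈ V n → y ∈ E * C n := by
      intro n
      have : ∀ f : Z, ∃ e : Z, ∀ y : Z, y ^ n * f ∈ V n → e⁻¹ * y ∈ C n := by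
        intro f
        by_cases hy : ∃ e : Z, e ^ n * f ∈ V n
        · obtain ⟨e, he⟩ := hy
          refine ⟨e, fun y hy => ?_⟩
          refine ⟨(e ^ n * f)⁻¹, by rw [← hVi]; exact Set.inv_mem_inv.2 he, _, hy, ?_⟩
          simp only
          rw [mul_pow, inv_pow, mul_inv, mul_mul_mul_comm, mul_comm f⁻¹ f, mul_inv_cancel,
            mul_one]
        · exact ⟨1, fun y hy' => (hy ⟨y, hy'⟩).elim⟩
      choose e he using this
      exact ⟨e '' F, hF.image e, fun y f hf hy =>
        ⟨e f, mem_image_of_mem e hf, _, he f y hy, by simp⟩⟩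
    choose E hEf hE using hE
    obtain ⟨y, hy⟩ := exists_notMem_mul_of_forall_notMem_mul_inv C (Finset.Icc 1 i)
      (fun n hn F hF => by
      obtain ⟨z, hz⟩ := hUF n (Finset.mem_Icc.1 hn).1 ((· ^ n) '' F) (hF.image _)
      refine ⟨z, ?_⟩
      rintro ⟨f, hf, _, ⟨c, hc, d, hd, rfl⟩, rfl⟩
      refine hz ⟨f ^ n, mem_image_of_mem _ hf, c ^ n * d ^ n, hVU n ?_, by simp [mul_pow]⟩
      refine Set.mul_mem_mul hc ?_
      have hd' : (d⁻¹) ^ n ∈ V n * V n := hd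
      have : d ^ n ∈ (V n * V n)⁻¹ := by rw [Set.mem_inv, ← inv_pow]; exact hd'
      rwa [mul_inv_rev, hVi] at this) E (fun n _ => hEf n)
    exact ⟨y, fun n hn f hf hyf => hy n hn (hE n y f hf hyf)⟩
  -- the `i`-th term avoids the translates by products of earlier terms with exponents up to `i`
  obtain ⟨a, ha⟩ := exists_seq_of_forall_initial
    (fun (i : ℕ) (f : Fin i → Z) (y : Z) => ∀ n ∈ Finset.Icc 1 i,
      ∀ c : Fin i → ℤ, (∀ j, c j ∈ Finset.Icc (-i : ℤ) i) → y ^ n * ∏ j, f j ^ c j ∉ V n)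
    (fun i f => by
      have hfin : ((fun c : Fin i → ℤ => ∏ j, f j ^ c j) ''
          {c | ∀ j, c j ∈ Finset.Icc (-i : ℤ) i}).Finite := by
        refine Set.Finite.image _ ?_
        have := Set.Finite.pi' (fun _ : Fin i => (Finset.Icc (-i : ℤ) i).finite_toSet)
        simpa using this
      obtain ⟨y, hy⟩ := h3 i _ hfin
      exact ⟨y, fun n hn c hc => hy n hn _ (mem_image_of_mem _ hc)⟩)
  refine ⟨a, fun K => ⟨⋂ n ∈ Finset.range (K + 1), V n,
    (Filter.biInter_finset_mem _).2 fun n _ => hV n, fun w w' hne hw hw' hKw hKw' hmem => ?_⟩⟩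
  obtain ⟨i, hi, heq⟩ := exists_wordProd_div_eq a w w' hne
  have hc : ∀ j, w.count j ≤ K ∧ w'.count j ≤ K := fun j =>
    ⟨(Multiset.count_le_card j w).trans hw, (Multiset.count_le_card j w').trans hw'⟩
  have hKi : K ≤ i := by
    by_cases h : i ∈ w
    · exact hKw i h
    · refine hKw' i (Multiset.count_ne_zero.1 fun h' => hi ?_)
      rw [h', Multiset.count_eq_zero.2 h]
  rw [heq] at hmem
  simp only [mem_iInter, Finset.mem_range] at hmem
  have hci := hc i
  rcases lt_or_gt_of_ne hi with hlt | hlt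
  · refine ha i (w'.count i - w.count i) (Finset.mem_Icc.2 (by omega))
      (fun j => (w'.count (j : ℕ) : ℤ) - w.count (j : ℕ)) (fun j => ?_) ?_
    · have := hc j
      exact Finset.mem_Icc.2 (by omega)
    · have := hmem (w'.count i - w.count i) (by omega)
      rw [← hVi, Set.mem_inv, mul_inv, ← zpow_neg, ← Finset.prod_inv_distrib] at this
      convert this using 2
      · rw [← zpow_natCast]; congr 1; omega
      · refine Finset.prod_congr rfl fun j _ => ?_
        rw [← zpow_neg, neg_sub]
  · refine ha i (w.count i - w'.count i) (Finset.mem_Icc.2 (by omega))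
      (fun j => (w.count (j : ℕ) : ℤ) - w'.count (j : ℕ)) (fun j => ?_) ?_
    · have := hc j
      exact Finset.mem_Icc.2 (by omega)
    · have := hmem (w.count i - w'.count i) (by omega)
      convert this using 2
      rw [← zpow_natCast]; congr 1; omega

end Comm

/-! ### A semigroup topology on the product of a group with the natural numbers -/

section Extension

variable {G : Type u} [Group G]

/-- The property of a sequence of central elements on which the extension of the group rests: the
products of two different words of bounded length in distant terms are uniformly apart. -/
def WordsApart [TopologicalSpace G] (a : ℕ → Subgroup.center G) : Prop :=
  ∀ K : ℕ, ∃ W ∈ 𝓝 (1 : Subgroup.center G), ∀ w w' : Multiset ℕ, w ≠ w' → w.card ≤ K →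
    w'.card ≤ K → (∀ i ∈ w, K ≤ i) → (∀ i ∈ w', K ≤ i) → wordProd a w / wordProd a w' ∉ W

theorem mul_wordProd_comm (a : ℕ → Subgroup.center G) (w : Multiset ℕ) (g : G) :
    g * ((wordProd a w : Subgroup.center G) : G) = wordProd a w * g :=
  Subgroup.mem_center_iff.1 (wordProd a w).2 g

/-- The monoid `G × ℕ` with the topology in which the distant products of `k - i` terms of a
sequence `a` of central elements of `G`, put at the level `i`, are near the point `(1, k)`; in
particular, `(a i, 0)` tends to `(1, 1)`. -/
@[ext] structure LevelSemigroup (a : ℕ → Subgroup.center G) where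
  /-- The component in the group. -/
  elt : G
  /-- The component in `ℕ`. -/
  level : ℕ

namespace LevelSemigroup

variable {a : ℕ → Subgroup.center G}

instance : Semigroup (LevelSemigroup a) where
  mul p q := ⟨p.elt * q.elt, p.level + q.level⟩
  mul_assoc _ _ _ := LevelSemigroup.ext (mul_assoc _ _ _) (add_assoc _ _ _)

theorem mul_def (p q : LevelSemigroup a) : p * q = ⟨p.elt * q.elt, p.level + q.level⟩ := rfl

/-- The basic neighborhood of `p`, given by a neighborhood `U` of the unit and a bound `m` for the
indices of the terms of the sequence. -/
def box (p : LevelSemigroup a) (U : Set G) (m : ℕ) : Set (LevelSemigroup a) :=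
  {q | ∃ u ∈ U, ∃ w : Multiset ℕ, (∀ i ∈ w, m ≤ i) ∧ q.elt = p.elt * u * wordProd a w ∧
    q.level + w.card = p.level}

theorem box_mono (p : LevelSemigroup a) {U V : Set G} (h : U ⊆ V) {m n : ℕ} (hmn : n ≤ m) :
    box p U m ⊆ box p V n := by
  rintro q ⟨u, hu, w, hw, h1, h2⟩
  exact ⟨u, h hu, w, fun i hi => hmn.trans (hw i hi), h1, h2⟩

end LevelSemigroup

variable [TopologicalSpace G]

/-- The separation of the points `(1, k)` and `(x, l)` by neighborhoods made of translates of
products of words. If the separation failed, the quotients of the products of two different words in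
arbitrarily distant terms would come near `x`, and dividing two such quotients with disjoint sets of
terms would give quotients of products of different words near the unit. -/
theorem WordsApart.exists_nhds_separating [IsTopologicalGroup G] [T2Space G]
    {a : ℕ → Subgroup.center G} (ha : WordsApart a) (x : G) (k l : ℕ) (hx : ¬ (x = 1 ∧ k = l)) :
    ∃ U ∈ 𝓝 (1 : G), ∃ m : ℕ, ∀ w w' : Multiset ℕ, (∀ i ∈ w, m ≤ i) → (∀ i ∈ w', m ≤ i) →
      w.card ≤ k → w'.card ≤ l → w.card + l = w'.card + k → ∀ u ∈ U, ∀ v ∈ U,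
        u * ((wordProd a w : Subgroup.center G) : G) ≠
          x * v * ((wordProd a w' : Subgroup.center G) : G) := by
  obtain ⟨W, hW, hWa⟩ := ha (k + l)
  obtain ⟨W', hW', hWW'⟩ := mem_nhds_subtype (Subgroup.center G : Set G) 1 W |>.1 hW
  -- `O` is so small that `O * O⁻¹ ⊆ W'`, and that `x⁻¹ ∉ O` unless `x = 1`
  obtain ⟨O, hO, hOW, hOx⟩ : ∃ O ∈ 𝓝 (1 : G), (∀ y ∈ O, ∀ z ∈ O, y / z ∈ W') ∧
      (x ≠ 1 → x⁻¹ ∉ O) := by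
    obtain ⟨O, hO, hO'⟩ := exists_nhds_split_inv hW'
    by_cases hx1 : x = 1
    · exact ⟨O, hO, hO', fun h => (h hx1).elim⟩
    · have : {x⁻¹}ᶜ ∈ 𝓝 (1 : G) := by
        refine isOpen_compl_singleton.mem_nhds fun h => hx1 ?_
        simpa using (mem_singleton_iff.1 h).symm
      exact ⟨O ∩ {x⁻¹}ᶜ, inter_mem hO this, fun y hy z hz => hO' y hy.1 z hz.1, fun _ h => h.2 rfl⟩
  obtain ⟨U, hU, hUO⟩ : ∃ U ∈ 𝓝 (1 : G), ∀ u ∈ U, ∀ v ∈ U, u⁻¹ * (x * v * x⁻¹) ∈ O := by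
    have hc : Continuous fun p : G × G => p.1⁻¹ * (x * p.2 * x⁻¹) := by fun_prop
    have hc1 : Tendsto (fun p : G × G => p.1⁻¹ * (x * p.2 * x⁻¹)) (𝓝 1 ×ˢ 𝓝 1) (𝓝 1) := by
      have := hc.tendsto ((1 : G), (1 : G))
      rw [nhds_prod_eq] at this
      simpa using this
    obtain ⟨U, hU, hUO⟩ := (((𝓝 (1 : G)).basis_sets.prod_self).tendsto_left_iff).1 hc1 O hO
    exact ⟨U, hU, fun u hu v hv => hUO (Set.mk_mem_prod hu hv)⟩
  have hsol : ∀ w w' : Multiset ℕ, ∀ u ∈ U, ∀ v ∈ U,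
      u * ((wordProd a w : Subgroup.center G) : G) = x * v * wordProd a w' →
        ((wordProd a w / wordProd a w' : Subgroup.center G) : G) * x⁻¹ ∈ O := by
    intro w w' u hu v hv h
    convert hUO u hu v hv using 1
    have h' : ((wordProd a w : Subgroup.center G) : G) = u⁻¹ * (x * v * wordProd a w') := by
      rw [← h, inv_mul_cancel_left]
    rw [Subgroup.coe_div, h', div_eq_mul_inv]
    group
  refine ⟨U, hU, ?_⟩
  by_contra! hcon
  -- take a solution `(w, w')`, and a solution `(t, t')` in terms beyond those of `w` and `w'`
  obtain ⟨w, w', hw, hw', hk, hl, hkl, u, hu, v, hv, h⟩ := hcon (k + l)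
  obtain ⟨N, hN⟩ : ∃ N, ∀ i ∈ w + w', i < N :=
    ⟨(w + w').sup + 1, fun i hi => Nat.lt_succ_of_le (Multiset.le_sup hi)⟩
  obtain ⟨t, t', ht, ht', htk, htl, htkl, u₁, hu₁, v₁, hv₁, h₁⟩ := hcon (max N (k + l))
  have hs := hsol w w' u hu v hv h
  have hs₁ := hsol t t' u₁ hu₁ v₁ hv₁ h₁
  have hne : w ≠ w' := by
    rintro rfl
    have hkl' : k = l := by omega
    refine hOx (fun h => hx ⟨h, hkl'⟩) ?_
    simpa using hs
  have hne' : w + t' ≠ w' + t := by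
    intro heq
    refine hne (Multiset.ext.2 fun i => ?_)
    by_cases hi : i < N
    · have hc := congrArg (Multiset.count i) heq
      have h1 : t.count i = 0 := Multiset.count_eq_zero.2 fun h' => absurd (ht i h') (by omega)
      have h2 : t'.count i = 0 := Multiset.count_eq_zero.2 fun h' => absurd (ht' i h') (by omega)
      rwa [Multiset.count_add, Multiset.count_add, h1, h2] at hc
    · rw [Multiset.count_eq_zero.2, Multiset.count_eq_zero.2] <;>
        exact fun h' => hi (hN i (by simp [h']))
  refine hWa (w + t') (w' + t) hne' ?_ ?_ ?_ ?_ (hWW' ?_)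
  · rw [Multiset.card_add]; omega
  · rw [Multiset.card_add]; omega
  · intro i hi
    rcases Multiset.mem_add.1 hi with hi | hi
    · exact hw i hi
    · exact (le_max_right _ _).trans (ht' i hi)
  · intro i hi
    rcases Multiset.mem_add.1 hi with hi | hi
    · exact hw' i hi
    · exact (le_max_right _ _).trans (ht i hi)
  · have : ((wordProd a w / wordProd a w' / (wordProd a t / wordProd a t') : Subgroup.center G) : G)
        ∈ W' := by
      simpa using hOW _ hs _ hs₁
    rw [Set.mem_preimage, wordProd_add, wordProd_add, ← div_mul_div_comm]
    rwa [div_eq_mul_inv, inv_div] at this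

namespace LevelSemigroup

variable {a : ℕ → Subgroup.center G}

/-- The filter of neighborhoods of a point. -/
def nhdsFilter (p : LevelSemigroup a) : Filter (LevelSemigroup a) where
  sets := {s | ∃ U ∈ 𝓝 (1 : G), ∃ m, box p U m ⊆ s}
  univ_sets := ⟨univ, univ_mem, 0, subset_univ _⟩
  sets_of_superset := fun ⟨U, hU, m, h⟩ h' => ⟨U, hU, m, h.trans h'⟩
  inter_sets := fun ⟨U, hU, m, h⟩ ⟨V, hV, n, h'⟩ => ⟨U ∩ V, inter_mem hU hV, max m n,
    subset_inter ((box_mono p inter_subset_left (le_max_left m n)).trans h)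
      ((box_mono p inter_subset_right (le_max_right m n)).trans h')⟩

theorem nhdsFilter_hasBasis (p : LevelSemigroup a) :
    (nhdsFilter p).HasBasis (fun i : Set G × ℕ => i.1 ∈ 𝓝 (1 : G)) fun i => box p i.1 i.2 := by
  refine ⟨fun s => ⟨?_, ?_⟩⟩
  · rintro ⟨U, hU, m, h⟩
    exact ⟨(U, m), hU, h⟩
  · rintro ⟨⟨U, m⟩, hU, h⟩
    exact ⟨U, hU, m, h⟩

instance : TopologicalSpace (LevelSemigroup a) := .mkOfNhds nhdsFilter

variable [IsTopologicalGroup G]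

theorem nhds_hasBasis (p : LevelSemigroup a) :
    (𝓝 p).HasBasis (fun i : Set G × ℕ => i.1 ∈ 𝓝 (1 : G)) fun i => box p i.1 i.2 := by
  have : 𝓝 p = nhdsFilter p := by
    refine TopologicalSpace.nhds_mkOfNhds_of_hasBasis (fun p => nhdsFilter_hasBasis p) ?_ ?_ p
    · rintro p ⟨U, m⟩ hU
      exact ⟨1, mem_of_mem_nhds hU, 0, by simp⟩
    · rintro p ⟨U, m⟩ hU
      obtain ⟨V, hV, hVU⟩ := exists_nhds_one_split hU
      refine ⟨V, hV, m, ?_⟩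
      rintro q ⟨u, hu, w, hw, h1, h2⟩
      refine ⟨V, hV, m, ?_⟩
      rintro r ⟨u', hu', w', hw', h1', h2'⟩
      refine ⟨u * u', hVU u hu u' hu', w + w', ?_, ?_, ?_⟩
      · intro i hi
        exact (Multiset.mem_add.1 hi).elim (hw i) (hw' i)
      · rw [h1', h1, wordProd_add, Subgroup.coe_mul, mul_assoc (p.elt * u), ← mul_wordProd_comm]
        simp only [mul_assoc]
      · rw [Multiset.card_add]; omega
  rw [this]
  exact nhdsFilter_hasBasis p

instance : ContinuousMul (LevelSemigroup a) where
  continuous_mul := by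
    refine continuous_iff_continuousAt.2 fun ⟨p, q⟩ => ?_
    rw [ContinuousAt, nhds_prod_eq,
      ((nhds_hasBasis p).prod (nhds_hasBasis q)).tendsto_iff (nhds_hasBasis _)]
    rintro ⟨U, m⟩ hU
    obtain ⟨V, hV, hVU⟩ := exists_nhds_one_split hU
    have hV' : (fun x => q.elt⁻¹ * x * q.elt) ⁻¹' V ∈ 𝓝 (1 : G) := by
      have hc : Continuous fun x : G => q.elt⁻¹ * x * q.elt := by fun_prop
      exact hc.tendsto' 1 1 (by simp) hV
    refine ⟨((_, m), (V, m)), ⟨hV', hV⟩, ?_⟩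
    rintro ⟨x, y⟩ ⟨⟨u, hu, w, hw, h1, h2⟩, v, hv, w', hw', h1', h2'⟩
    refine ⟨q.elt⁻¹ * u * q.elt * v, hVU _ hu _ hv, w + w', ?_, ?_, ?_⟩
    · intro i hi
      exact (Multiset.mem_add.1 hi).elim (hw i) (hw' i)
    · simp only [mul_def] at *
      rw [h1, h1', wordProd_add, Subgroup.coe_mul,
        mul_assoc _ ((wordProd a w : Subgroup.center G) : G),
        ← mul_assoc ((wordProd a w : Subgroup.center G) : G), ← mul_wordProd_comm]
      group
    · simp only [mul_def, Multiset.card_add] at *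
      omega

theorem t2Space [T2Space G] (ha : WordsApart a) : T2Space (LevelSemigroup a) := by
  refine t2Space_iff_disjoint_nhds.2 fun p q hpq => ?_
  obtain ⟨U, hU, m, h⟩ := ha.exists_nhds_separating (p.elt⁻¹ * q.elt) p.level q.level fun h =>
    hpq (LevelSemigroup.ext (inv_mul_eq_one.1 h.1) h.2)
  refine ((nhds_hasBasis p).disjoint_iff (nhds_hasBasis q)).2 ⟨(U, m), hU, (U, m), hU, ?_⟩
  refine Set.disjoint_left.2 ?_
  rintro r ⟨u, hu, w, hw, h1, h2⟩ ⟨v, hv, w', hw', h1', h2'⟩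
  refine h w w' hw hw' (by omega) (by omega) (by omega) u hu v hv ?_
  rw [h1, mul_assoc, mul_assoc] at h1'
  rw [mul_assoc, mul_assoc, ← h1', inv_mul_cancel_left]

theorem continuous_mk_zero : Continuous fun g : G => (⟨g, 0⟩ : LevelSemigroup a) := by
  refine continuous_iff_continuousAt.2 fun g => ?_
  rw [ContinuousAt, (nhds_hasBasis _).tendsto_right_iff]
  rintro ⟨U, m⟩ hU
  have : ∀ᶠ x in 𝓝 g, g⁻¹ * x ∈ U :=
    (continuous_const_mul g⁻¹).tendsto' g 1 (inv_mul_cancel g) hU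
  filter_upwards [this] with x hx
  exact ⟨_, hx, 0, by simp, by simp, rfl⟩

theorem tendsto_mk_zero : Tendsto (fun i => (⟨a i, 0⟩ : LevelSemigroup a)) atTop
    (𝓝 (⟨1, 1⟩ : LevelSemigroup a)) := by
  rw [(nhds_hasBasis _).tendsto_right_iff]
  rintro ⟨U, m⟩ hU
  filter_upwards [eventually_ge_atTop m] with i hi
  exact ⟨1, mem_of_mem_nhds hU, {i}, by simpa using hi, by simp, rfl⟩

end LevelSemigroup
end Extension

/-! ### Adjoining positive levels to a group -/

section Adjunction

variable {X G : Type u} [Group X] [Group G]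

/-- The disjoint union of a group `X` and of the positive levels of `LevelSemigroup a`, where `X`
acts on the positive levels through the homomorphism `q : X →* G`. The element `adjoined g k` is
at the level `k + 1`. -/
inductive Adjunction (q : X →* G) (a : ℕ → Subgroup.center G) : Type u
  /-- The inclusion of the group. -/
  | base : X → Adjunction q a
  /-- The inclusion of the positive levels. -/
  | adjoined : G → ℕ → Adjunction q a

namespace Adjunction

variable {q : X →* G} {a : ℕ → Subgroup.center G}

/-- The map to `LevelSemigroup a` that equals `q` on the group, and the identity on the positive
levels. -/
def toLevel : Adjunction q a → LevelSemigroup a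
  | base x => ⟨q x, 0⟩
  | adjoined g k => ⟨g, k + 1⟩

instance : Mul (Adjunction q a) where
  mul
    | base x, base y => base (x * y)
    | base x, adjoined g k => adjoined (q x * g) k
    | adjoined g k, base x => adjoined (g * q x) k
    | adjoined g k, adjoined h l => adjoined (g * h) (k + l + 1)

@[simp] theorem base_mul_base (x y : X) : (base x * base y : Adjunction q a) = base (x * y) := rfl

@[simp] theorem base_mul_adjoined (x : X) (g : G) (k : ℕ) :
    (base x * adjoined g k : Adjunction q a) = adjoined (q x * g) k := rfl

@[simp] theorem adjoined_mul_base (x : X) (g : G) (k : ℕ) :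
    (adjoined g k * base x : Adjunction q a) = adjoined (g * q x) k := rfl

@[simp] theorem adjoined_mul_adjoined (g h : G) (k l : ℕ) :
    (adjoined g k * adjoined h l : Adjunction q a) = adjoined (g * h) (k + l + 1) := rfl

theorem toLevel_mul (y z : Adjunction q a) : toLevel (y * z) = toLevel y * toLevel z := by
  rcases y with x | ⟨g, k⟩ <;> rcases z with x' | ⟨g', k'⟩ <;>
    simp [toLevel, LevelSemigroup.mul_def]
  omega

theorem base_injective : Function.Injective (base : X → Adjunction q a) := fun _ _ h => by
  cases h; rfl

instance : Semigroup (Adjunction q a) where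
  mul_assoc := by
    rintro (x | ⟨g, k⟩) (x' | ⟨g', k'⟩) (x'' | ⟨g'', k''⟩) <;> simp [mul_assoc]
    all_goals omega

variable [TopologicalSpace X] [TopologicalSpace G]

/-- The group is open with its own topology, and the neighborhoods of the points of positive levels
are the preimages of their neighborhoods in `LevelSemigroup a`. -/
instance : TopologicalSpace (Adjunction q a) where
  IsOpen s := IsOpen (base ⁻¹' s) ∧ ∀ g k, adjoined g k ∈ s →
    s ∈ comap toLevel (𝓝 (⟨g, k + 1⟩ : LevelSemigroup a))
  isOpen_univ := ⟨isOpen_univ, fun _ _ _ => univ_mem⟩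
  isOpen_inter _ _ hs ht := ⟨hs.1.inter ht.1, fun g k h =>
    inter_mem (hs.2 g k h.1) (ht.2 g k h.2)⟩
  isOpen_sUnion S hS := ⟨by
    rw [preimage_sUnion]
    exact isOpen_biUnion fun s hs => (hS s hs).1, fun g k ⟨s, hs, h⟩ =>
      mem_of_superset ((hS s hs).2 g k h) (subset_sUnion_of_mem hs)⟩

theorem isOpenEmbedding_base : IsOpenEmbedding (base : X → Adjunction q a) := by
  refine .of_continuous_injective_isOpenMap ?_ base_injective ?_
  · exact continuous_def.2 fun s hs => hs.1
  · intro s hs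
    refine ⟨by rwa [preimage_image_eq _ base_injective], ?_⟩
    rintro g k ⟨x, _, hx⟩
    cases hx

variable [IsTopologicalGroup G]

theorem continuous_toLevel (hq : Continuous q) :
    Continuous (toLevel : Adjunction q a → LevelSemigroup a) := by
  refine continuous_def.2 fun s hs => ⟨?_, fun g k h => preimage_mem_comap (hs.mem_nhds h)⟩
  exact hs.preimage (LevelSemigroup.continuous_mk_zero.comp hq)

theorem nhds_adjoined (hq : Continuous q) (g : G) (k : ℕ) :
    𝓝 (adjoined g k : Adjunction q a) = comap toLevel (𝓝 (⟨g, k + 1⟩ : LevelSemigroup a)) := by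
  refine le_antisymm ?_ fun s hs => ?_
  · exact tendsto_iff_comap.1 (continuous_toLevel hq).continuousAt
  · obtain ⟨t, hts, ht, hgt⟩ := mem_nhds_iff.1 hs
    exact mem_of_superset (ht.2 g k hgt) hts

theorem t2Space [T2Space X] [T2Space G] (hq : Continuous q) (ha : WordsApart a) :
    T2Space (Adjunction q a) := by
  have := LevelSemigroup.t2Space ha
  have key : ∀ y z : Adjunction q a, toLevel y ≠ toLevel z → Disjoint (𝓝 y) (𝓝 z) := fun y z h =>
    ((continuous_toLevel hq).tendsto y).disjoint (disjoint_nhds_nhds.2 h)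
      ((continuous_toLevel hq).tendsto z)
  refine t2Space_iff_disjoint_nhds.2 ?_
  rintro (x | ⟨g, k⟩) (x' | ⟨g', k'⟩) hne
  · rw [← isOpenEmbedding_base.map_nhds_eq, ← isOpenEmbedding_base.map_nhds_eq,
      Filter.disjoint_map base_injective]
    exact disjoint_nhds_nhds.2 fun h => hne (congrArg base h)
  · exact key _ _ fun h => by simpa [toLevel] using congrArg LevelSemigroup.level h
  · exact key _ _ fun h => by simpa [toLevel] using congrArg LevelSemigroup.level h
  · refine key _ _ fun h => hne ?_
    simp only [toLevel, LevelSemigroup.mk.injEq] at h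
    rw [h.1, Nat.succ_injective h.2]

theorem continuousMul [IsTopologicalGroup X] (hq : Continuous q) :
    ContinuousMul (Adjunction q a) := by
  have key : ∀ (y z : Adjunction q a) (g : G) (k : ℕ), y * z = adjoined g k →
      ContinuousAt (fun p : Adjunction q a × Adjunction q a => p.1 * p.2) (y, z) := by
    intro y z g k h
    have hl : toLevel (y * z) = ⟨g, k + 1⟩ := congrArg toLevel h
    rw [ContinuousAt, h, nhds_adjoined hq, tendsto_comap_iff, ← hl]
    have hc : Continuous (toLevel ∘ fun p : Adjunction q a × Adjunction q a => p.1 * p.2) := by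
      have : (toLevel ∘ fun p : Adjunction q a × Adjunction q a => p.1 * p.2) =
          fun p => toLevel p.1 * toLevel p.2 := funext fun p => toLevel_mul p.1 p.2
      rw [this]
      exact ((continuous_toLevel hq).comp continuous_fst).mul
        ((continuous_toLevel hq).comp continuous_snd)
    exact hc.continuousAt
  refine ⟨continuous_iff_continuousAt.2 ?_⟩
  rintro ⟨x | ⟨g, k⟩, x' | ⟨g', k'⟩⟩
  · refine ((isOpenEmbedding_base.prodMap isOpenEmbedding_base).continuousAt_iff
      (x := (x, x'))).1 ?_
    exact (isOpenEmbedding_base.continuous.comp continuous_mul).continuousAt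
  · exact key _ _ _ _ rfl
  · exact key _ _ _ _ rfl
  · exact key _ _ _ _ rfl

theorem not_isClosed_range_base (hq : Continuous q) (hqs : Function.Surjective q) :
    ¬ IsClosed (range (base : X → Adjunction q a)) := by
  intro h
  choose x hx using fun i => hqs (a i)
  have hlim : Tendsto (fun i => (base (x i) : Adjunction q a)) atTop (𝓝 (adjoined 1 0)) := by
    rw [nhds_adjoined hq, tendsto_comap_iff]
    refine LevelSemigroup.tendsto_mk_zero.congr fun i => ?_
    simp [toLevel, hx]
  obtain ⟨y, hy⟩ := h.mem_of_tendsto hlim (Eventually.of_forall fun i => mem_range_self _)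
  cases hy

end Adjunction

/-- Closedness in all Hausdorff topological semigroups of the universe of the group itself. -/
theorem IsETSClosed.isClosed_range {X : Type u} [TopologicalSpace X] [Group X]
    (h : IsETSClosed.{u, max u v} X) {Y : Type u} [TopologicalSpace Y] [Semigroup Y]
    [ContinuousMul Y] [T2Space Y] (f : X →ₙ* Y) (hf : IsEmbedding f) : IsClosed (range f) := by
  have := h (ULift.{v} Y) ((MulEquiv.ulift.symm : Y ≃* ULift.{v} Y).toMulHom.comp f)
    (Homeomorph.ulift.symm.isEmbedding.comp hf)
  have h2 := this.preimage (Homeomorph.ulift.{v} (X := Y)).symm.continuous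
  convert h2 using 1
  ext y
  constructor
  · rintro ⟨x, rfl⟩
    exact ⟨x, rfl⟩
  · rintro ⟨x, hx⟩
    exact ⟨x, congrArg ULift.down hx⟩

/-- In a Hausdorff quotient of an `e:TS`-closed group, the powers of central elements with some
positive exponent form a totally bounded set. -/
theorem IsETSClosed.exists_leftTotallyBounded_center {X G : Type u} [TopologicalSpace X] [Group X]
    [IsTopologicalGroup X] [T2Space X] [TopologicalSpace G] [Group G] [IsTopologicalGroup G]
    [T2Space G] (h : IsETSClosed.{u, max u v} X) (q : X →* G) (hq : Continuous q)
    (hqs : Function.Surjective q) :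
    ∃ n : ℕ, 1 ≤ n ∧ LeftTotallyBounded ((fun z : G => z ^ n) '' Subgroup.center G) := by
  by_contra! hcon
  obtain ⟨a, ha⟩ := exists_seq_wordProd_apart (Z := Subgroup.center G) fun n hn htb => by
    refine hcon n hn fun U hU => ?_
    obtain ⟨F, hF, hFU⟩ := htb (Subtype.val ⁻¹' U)
      (continuous_subtype_val.continuousAt.preimage_mem_nhds (by simpa using hU))
    refine ⟨Subtype.val '' F, hF.image _, ?_⟩
    rintro _ ⟨z, hz, rfl⟩
    obtain ⟨f, hf, u, hu, hfu⟩ := hFU ⟨⟨z, hz⟩, rfl⟩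
    exact ⟨f, mem_image_of_mem _ hf, u, hu, congrArg Subtype.val hfu⟩
  have := Adjunction.continuousMul (a := a) hq
  have := Adjunction.t2Space (a := a) hq ha
  exact Adjunction.not_isClosed_range_base hq hqs
    (h.isClosed_range (Y := Adjunction q a) ⟨Adjunction.base, fun _ _ => rfl⟩
      Adjunction.isOpenEmbedding_base.isEmbedding)

end Adjunction

/-! ### Total boundedness of powers in nilpotent groups -/

section TotallyBounded

variable {G : Type u} [Group G] [TopologicalSpace G] [IsTopologicalGroup G]

/-- The finite set in the definition of left total boundedness can be taken in the set itself. -/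
theorem LeftTotallyBounded.exists_finite_subset {A : Set G} (hA : LeftTotallyBounded A) {U : Set G}
    (hU : U ∈ 𝓝 (1 : G)) : ∃ F ⊆ A, F.Finite ∧ A ⊆ F * U := by
  obtain ⟨V, hV, -, hVi, hVU⟩ := exists_closed_nhds_one_inv_eq_mul_subset hU
  obtain ⟨F, hF, hAF⟩ := hA V hV
  have : ∀ f : G, ∃ b : G, (∃ c ∈ A, c ∈ f • V) → b ∈ A ∧ b ∈ f • V := fun f => by
    by_cases h : ∃ c ∈ A, c ∈ f • V
    · exact ⟨h.choose, fun _ => h.choose_spec⟩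
    · exact ⟨1, fun h' => (h h').elim⟩
  choose b hb using this
  refine ⟨b '' F ∩ A, inter_subset_right, (hF.image b).inter_of_left A, fun x hx => ?_⟩
  obtain ⟨f, hf, v, hv, rfl⟩ := hAF hx
  obtain ⟨h1, w, hw, h2⟩ := hb f ⟨f * v, hx, v, hv, rfl⟩
  refine ⟨b f, ⟨mem_image_of_mem b hf, h1⟩, w⁻¹ * v, hVU (Set.mul_mem_mul ?_ hv), ?_⟩
  · rw [← hVi]; exact Set.inv_mem_inv.2 hw
  · simp [← h2, mul_assoc]

/-- If the `m`-th powers are totally bounded modulo the center, then the conjugations by the `m`-th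
powers are equicontinuous, since the conjugations by central elements are trivial. -/
theorem exists_nhds_conj_pow_mem {m : ℕ}
    (hm : ∀ U ∈ 𝓝 (1 : G), ∃ F : Set G, F.Finite ∧ ∀ x : G, ∃ f ∈ F, ∃ u ∈ U,
      ∃ z ∈ Subgroup.center G, x ^ m = f * u * z) {W : Set G} (hW : W ∈ 𝓝 (1 : G)) :
    ∃ U ∈ 𝓝 (1 : G), ∀ x : G, ∀ u ∈ U, (x ^ m)⁻¹ * u * x ^ m ∈ W := by
  obtain ⟨V, hV, hVW⟩ : ∃ V ∈ 𝓝 (1 : G), ∀ v ∈ V, ∀ u ∈ V, v⁻¹ * u * v ∈ W := by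
    have hc : Continuous fun p : G × G => p.1⁻¹ * p.2 * p.1 := by fun_prop
    have hc1 : Tendsto (fun p : G × G => p.1⁻¹ * p.2 * p.1) (𝓝 1 ×ˢ 𝓝 1) (𝓝 1) := by
      have := hc.tendsto ((1 : G), (1 : G))
      rw [nhds_prod_eq] at this
      simpa using this
    obtain ⟨V, hV, hVW⟩ := (((𝓝 (1 : G)).basis_sets.prod_self).tendsto_left_iff).1 hc1 W hW
    exact ⟨V, hV, fun v hv u hu => hVW (Set.mk_mem_prod hv hu)⟩
  obtain ⟨F, hF, hFx⟩ := hm V hV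
  refine ⟨⋂ f ∈ F, (fun u => f⁻¹ * u * f) ⁻¹' V, (biInter_mem hF).2 fun f _ => ?_, ?_⟩
  · have hc : Continuous fun u : G => f⁻¹ * u * f := by fun_prop
    exact hc.tendsto' 1 1 (by simp) hV
  · intro x u hu
    obtain ⟨f, hf, v, hv, z, hz, h⟩ := hFx x
    have := hVW v hv _ (mem_iInter₂.1 hu f hf)
    convert this using 1
    have hz' : ∀ g : G, z⁻¹ * g * z = g := fun g => by
      rw [mul_assoc, Subgroup.mem_center_iff.1 hz, inv_mul_cancel_left]
    rw [h, ← hz' (v⁻¹ * (f⁻¹ * u * f) * v)]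
    group

/-- If the `m`-th powers are totally bounded modulo the center, then `g ↦ g ^ n` is uniformly
continuous, for the left uniformity, at the `m`-th powers. -/
theorem exists_nhds_mul_pow_mem {m : ℕ}
    (hm : ∀ U ∈ 𝓝 (1 : G), ∃ F : Set G, F.Finite ∧ ∀ x : G, ∃ f ∈ F, ∃ u ∈ U,
      ∃ z ∈ Subgroup.center G, x ^ m = f * u * z) (n : ℕ) {W : Set G} (hW : W ∈ 𝓝 (1 : G)) :
    ∃ U ∈ 𝓝 (1 : G), ∀ x : G, ∀ u ∈ U, ((x ^ m) ^ n)⁻¹ * (x ^ m * u) ^ n ∈ W := by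
  induction n generalizing W with
  | zero => exact ⟨univ, univ_mem, fun x u _ => by simpa using mem_of_mem_nhds hW⟩
  | succ n ih =>
    obtain ⟨W', hW', hWW⟩ := exists_nhds_one_split hW
    obtain ⟨U₁, hU₁, h₁⟩ := exists_nhds_conj_pow_mem hm hW'
    obtain ⟨U₂, hU₂, h₂⟩ := ih hU₁
    refine ⟨U₂ ∩ W', inter_mem hU₂ hW', fun x u hu => ?_⟩
    have := hWW _ (h₁ x _ (h₂ x u hu.1)) u hu.2
    convert this using 1
    rw [pow_succ, pow_succ, mul_inv_rev]
    simp only [mul_assoc]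

/-- Total boundedness of powers is inherited by central extensions. -/
theorem leftTotallyBounded_range_pow_mul {m n : ℕ}
    (hm : ∀ U ∈ 𝓝 (1 : G), ∃ F : Set G, F.Finite ∧ ∀ x : G, ∃ f ∈ F, ∃ u ∈ U,
      ∃ z ∈ Subgroup.center G, x ^ m = f * u * z)
    (hn : LeftTotallyBounded ((fun z : G => z ^ n) '' Subgroup.center G)) :
    LeftTotallyBounded (range fun x : G => x ^ (m * n)) := by
  intro W hW
  obtain ⟨W', hW', hWW⟩ := exists_nhds_one_split hW
  obtain ⟨U, hU, hUW⟩ := exists_nhds_mul_pow_mem hm n hW'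
  obtain ⟨V, hV, -, hVi, hVU⟩ := exists_closed_nhds_one_inv_eq_mul_subset hU
  obtain ⟨F, hF, hFx⟩ := hm V hV
  obtain ⟨E, hEc, hE, hEW⟩ := hn.exists_finite_subset hW'
  have : ∀ f : G, ∃ b : G, (∃ x : G, ∃ u ∈ V, ∃ z ∈ Subgroup.center G, x ^ m = f * u * z) →
      ∃ u ∈ V, ∃ z ∈ Subgroup.center G, b ^ m = f * u * z := fun f => by
    by_cases h : ∃ x : G, ∃ u ∈ V, ∃ z ∈ Subgroup.center G, x ^ m = f * u * z
    · exact ⟨h.choose, fun _ => h.choose_spec⟩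
    · exact ⟨1, fun h' => (h h').elim⟩
  choose b hb using this
  refine ⟨(fun f => b f ^ (m * n)) '' F * E, (hF.image _).mul hE, ?_⟩
  rintro _ ⟨y, rfl⟩
  obtain ⟨f, hf, u, hu, z, hz, h⟩ := hFx y
  obtain ⟨u', hu', z', hz', h'⟩ := hb f ⟨y, u, hu, z, hz, h⟩
  -- `y ^ m` is `b f ^ m` times a small element, up to the central factor `z * z'⁻¹`
  have hc : z * z'⁻¹ ∈ Subgroup.center G := mul_mem hz (inv_mem hz')
  have hy : y ^ m = b f ^ m * (u'⁻¹ * u) * (z * z'⁻¹) := by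
    have h2 : ∀ g : G, z'⁻¹ * g = g * z'⁻¹ := fun g =>
      (Subgroup.mem_center_iff.1 (inv_mem hz') g).symm
    calc y ^ m = b f ^ m * (z'⁻¹ * (u'⁻¹ * u * z)) := by rw [h, h']; group
      _ = _ := by rw [h2]; simp only [mul_assoc]
  obtain ⟨e, he, w, hw, hew⟩ := hEW (mem_image_of_mem (fun z : G => z ^ n) hc)
  obtain ⟨c, hcc, rfl⟩ := hEc he
  have hcn := Subgroup.mem_center_iff.1 (pow_mem hcc n)
  have hyn : y ^ (m * n) = (b f ^ m * (u'⁻¹ * u)) ^ n * (z * z'⁻¹) ^ n := by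
    rw [pow_mul, hy]
    exact Commute.mul_pow (Subgroup.mem_center_iff.1 hc _) n
  have hsmall := hUW (b f) (u'⁻¹ * u)
    (hVU (Set.mul_mem_mul (by rw [← hVi]; exact Set.inv_mem_inv.2 hu') hu))
  refine ⟨_, Set.mul_mem_mul (mem_image_of_mem _ hf) he, _, hWW _ hsmall _ hw, ?_⟩
  simp only at hew hcn ⊢
  rw [hyn, ← hew, pow_mul, hcn, ← mul_assoc _ (c ^ n) w, hcn]
  simp only [mul_assoc, mul_inv_cancel_left]

theorem isClosed_center [T2Space G] : IsClosed (Subgroup.center G : Set G) := by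
  have : (Subgroup.center G : Set G) = ⋂ g : G, {z | g * z = z * g} := by
    ext z
    simp [Subgroup.mem_center_iff]
  rw [this]
  exact isClosed_iInter fun g => isClosed_eq (continuous_const_mul g) (continuous_mul_const g)

/-- Total boundedness in the quotient by the center, expressed in the group. -/
theorem LeftTotallyBounded.exists_eq_mul_mul_center {m : ℕ}
    (h : LeftTotallyBounded (range fun x : G ⧸ Subgroup.center G => x ^ m)) :
    ∀ U ∈ 𝓝 (1 : G), ∃ F : Set G, F.Finite ∧ ∀ x : G, ∃ f ∈ F, ∃ u ∈ U,
      ∃ z ∈ Subgroup.center G, x ^ m = f * u * z := by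
  intro U hU
  obtain ⟨F, hF, hFU⟩ := h _ (QuotientGroup.isOpenMap_coe.image_mem_nhds hU)
  refine ⟨Quotient.out '' F, hF.image _, fun x => ?_⟩
  obtain ⟨f, hf, _, ⟨u, hu, rfl⟩, hfu⟩ := hFU ⟨(x : G ⧸ Subgroup.center G), rfl⟩
  refine ⟨_, mem_image_of_mem _ hf, u, hu, (f.out * u)⁻¹ * x ^ m, ?_, by group⟩
  refine QuotientGroup.eq.1 ?_
  rw [QuotientGroup.mk_mul, QuotientGroup.out_eq']
  exact hfu

end TotallyBounded

/-- In a Hausdorff nilpotent quotient of an `e:TS`-closed group, the powers with some positive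
exponent form a totally bounded set. The statement is about all quotients, so as to be accessible to
induction on the nilpotency class. -/
theorem IsETSClosed.exists_leftTotallyBounded_range_pow {X : Type u} [TopologicalSpace X] [Group X]
    [IsTopologicalGroup X] [T2Space X] (h : IsETSClosed.{u, max u v} X) (G : Type u) [Group G]
    [Group.IsNilpotent G] : ∀ [TopologicalSpace G] [IsTopologicalGroup G] [T2Space G] (q : X →* G),
      Continuous q → Function.Surjective q →
        ∃ n : ℕ, 1 ≤ n ∧ LeftTotallyBounded (range fun x : G => x ^ n) := by
  refine Group.nilpotent_center_quotient_ind
    (P := fun (G : Type u) [Group G] [Group.IsNilpotent G] =>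
      ∀ [TopologicalSpace G] [IsTopologicalGroup G] [T2Space G] (q : X →* G),
      Continuous q → Function.Surjective q →
        ∃ n : ℕ, 1 ≤ n ∧ LeftTotallyBounded (range fun x : G => x ^ n)) G ?_ ?_
  · intro G _ _ _ _ _ q _ _
    refine ⟨1, le_rfl, fun U hU => ⟨{1}, Set.finite_singleton 1, fun x _ => ?_⟩⟩
    exact ⟨1, rfl, 1, mem_of_mem_nhds hU, Subsingleton.elim _ _⟩
  · intro G _ _ ih _ _ _ q hq hqs
    have := isClosed_center (G := G)
    obtain ⟨m, hm, hmG⟩ := ih ((QuotientGroup.mk' (Subgroup.center G)).comp q)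
      (QuotientGroup.continuous_mk.comp hq) ((QuotientGroup.mk'_surjective _).comp hqs)
    obtain ⟨n, hn, hnG⟩ := h.exists_leftTotallyBounded_center q hq hqs
    exact ⟨m * n, Nat.mul_pos hm hn,
      leftTotallyBounded_range_pow_mul hmG.exists_eq_mul_mul_center hnG⟩

/-! ### Left Cauchy filters and completeness -/

section LeftCauchy

variable {X : Type*} [TopologicalSpace X] [Group X]

/-- A filter on a topological group is left Cauchy if it is Cauchy in the left uniformity. -/
def LeftCauchy (F : Filter X) : Prop :=
  F.NeBot ∧ Tendsto (fun p : X × X => p.1⁻¹ * p.2) (F ×ˢ F) (𝓝 1)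

theorem leftCauchy_iff_cauchy [IsTopologicalGroup X] {F : Filter X} :
    LeftCauchy F ↔ @Cauchy X (IsTopologicalGroup.leftUniformSpace X) F :=
  and_congr_right fun _ => tendsto_iff_comap

theorem LeftCauchy.eventually {F : Filter X} (hF : LeftCauchy F) {U : Set X}
    (hU : U ∈ 𝓝 (1 : X)) : ∃ A ∈ F, ∀ x ∈ A, ∀ y ∈ A, x⁻¹ * y ∈ U := by
  obtain ⟨A, hA, h⟩ := ((F.basis_sets.prod_self).tendsto_left_iff).1 hF.2 U hU
  exact ⟨A, hA, fun x hx y hy => h (Set.mk_mem_prod hx hy)⟩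

theorem leftCauchy_iff {F : Filter X} : LeftCauchy F ↔
    F.NeBot ∧ ∀ U ∈ 𝓝 (1 : X), ∃ A ∈ F, ∀ x ∈ A, ∀ y ∈ A, x⁻¹ * y ∈ U :=
  ⟨fun h => ⟨h.1, fun _ => h.eventually⟩, fun h => ⟨h.1, fun U hU =>
    let ⟨_, hA, hAU⟩ := h.2 U hU
    mem_map.2 <| mem_of_superset (prod_mem_prod hA hA) fun p hp => hAU p.1 hp.1 p.2 hp.2⟩⟩

theorem LeftCauchy.mono {F F' : Filter X} [F'.NeBot] (hF : LeftCauchy F) (h : F' ≤ F) :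
    LeftCauchy F' :=
  ⟨inferInstance, hF.2.mono_left (Filter.prod_mono h h)⟩

variable [IsTopologicalGroup X]

/-- Products of left Cauchy filters are left Cauchy, since `(x * y)⁻¹ * (x' * y')` equals
`y⁻¹ * (x⁻¹ * x') * y'`, and `y`, `y'` may be compared with a fixed element. -/
theorem LeftCauchy.mul {F F' : Filter X} (hF : LeftCauchy F) (hF' : LeftCauchy F') :
    LeftCauchy (map (fun p : X × X => p.1 * p.2) (F ×ˢ F')) := by
  have := hF.1
  have := hF'.1
  refine ⟨inferInstance, ?_⟩
  rw [prod_map_map_eq, tendsto_map'_iff]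
  intro U hU
  obtain ⟨V, hV, hVU⟩ : ∃ V ∈ 𝓝 (1 : X), ∀ v ∈ V, ∀ w ∈ V, ∀ t ∈ V, v⁻¹ * w * t ∈ U := by
    have hc : Continuous fun p : X × X × X => p.1⁻¹ * p.2.1 * p.2.2 := by fun_prop
    have hc1 := hc.tendsto' (1, 1, 1) 1 (by simp) hU
    rw [Filter.mem_map, nhds_prod_eq, nhds_prod_eq, mem_prod_iff] at hc1
    obtain ⟨V₁, hV₁, V₂, hV₂, h⟩ := hc1
    obtain ⟨V₃, hV₃, V₄, hV₄, h'⟩ := mem_prod_iff.1 hV₂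
    refine ⟨V₁ ∩ (V₃ ∩ V₄), inter_mem hV₁ (inter_mem hV₃ hV₄), fun v hv w hw t ht => ?_⟩
    exact h (a := (v, w, t)) ⟨hv.1, h' ⟨hw.2.1, ht.2.2⟩⟩
  obtain ⟨B, hB, hBV⟩ := hF'.eventually hV
  obtain ⟨b, hb⟩ := hF'.1.nonempty_of_mem hB
  have hVb : (fun x => b⁻¹ * x * b) ⁻¹' V ∈ 𝓝 (1 : X) := by
    have hc : Continuous fun x : X => b⁻¹ * x * b := by fun_prop
    exact hc.tendsto' 1 1 (by simp) hV
  obtain ⟨A, hA, hAV⟩ := hF.eventually hVb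
  refine mem_map.2 (mem_of_superset (prod_mem_prod (prod_mem_prod hA hB) (prod_mem_prod hA hB)) ?_)
  rintro ⟨⟨x, y⟩, ⟨x', y'⟩⟩ ⟨⟨hx, hy⟩, hx', hy'⟩
  have := hVU (b⁻¹ * y) (hBV b hb y hy) _ (hAV x hx x' hx') (b⁻¹ * y') (hBV b hb y' hy')
  simp only [mem_preimage, Function.comp_apply]
  convert this using 1
  group

theorem leftCauchy_of_le_nhds {F : Filter X} [F.NeBot] {x : X} (h : F ≤ 𝓝 x) : LeftCauchy F := by
  refine ⟨inferInstance, ?_⟩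
  have hc : Continuous fun p : X × X => p.1⁻¹ * p.2 := by fun_prop
  have := hc.tendsto' (x, x) 1 (by simp)
  rw [nhds_prod_eq] at this
  exact this.mono_left (Filter.prod_mono h h)

/-- The pointwise product of two maps along which a filter is left Cauchy has the same property. -/
theorem LeftCauchy.map_mul {ι : Type*} {F : Filter ι} {f g : ι → X} (hf : LeftCauchy (map f F))
    (hg : LeftCauchy (map g F)) : LeftCauchy (map (fun i => f i * g i) F) := by
  have : F.NeBot := (map_neBot_iff f).1 hf.1
  have h : Tendsto (fun i => (f i, g i)) F (map f F ×ˢ map g F) := tendsto_map.prodMk tendsto_map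
  exact (hf.mul hg).mono (map_mono (m := fun p : X × X => p.1 * p.2) h)

theorem LeftCauchy.map_pow {F : Filter X} (hF : LeftCauchy F) (n : ℕ) :
    LeftCauchy (map (fun x => x ^ n) F) := by
  have := hF.1
  induction n with
  | zero =>
    exact leftCauchy_of_le_nhds (x := 1)
      (show Tendsto (fun x : X => x ^ 0) F (𝓝 1) by simp [tendsto_const_nhds])
  | succ n ih => simpa only [pow_succ, id] using ih.map_mul (g := id) (by simpa using hF)

theorem isWeilComplete_iff :
    IsWeilComplete X ↔ ∀ F : Filter X, LeftCauchy F → ∃ x, F ≤ 𝓝 x := by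
  let := IsTopologicalGroup.leftUniformSpace X
  simp only [leftCauchy_iff_cauchy]
  exact ⟨fun h F hF => h.complete hF, fun h => ⟨fun hF => h _ hF⟩⟩

theorem toTopologicalSpace_twoSidedUniformSpace :
    (twoSidedUniformSpace X).toTopologicalSpace = ‹TopologicalSpace X› :=
  UniformSpace.toTopologicalSpace_inf.trans (inf_idem _)

theorem cauchy_twoSidedUniformSpace_iff {F : Filter X} : @Cauchy X (twoSidedUniformSpace X) F ↔
    LeftCauchy F ∧ LeftCauchy (map (·⁻¹) F) := by
  have h : F ×ˢ F ≤ comap (fun p : X × X => p.2 * p.1⁻¹) (𝓝 1) ↔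
      Tendsto (fun p : X × X => p.1⁻¹ * p.2) (map (·⁻¹) F ×ˢ map (·⁻¹) F) (𝓝 1) := by
    rw [← tendsto_iff_comap, prod_map_map_eq, tendsto_map'_iff]
    constructor <;> exact fun h => (h.comp tendsto_prod_swap).congr fun p => by simp
  simp only [Cauchy, inf_uniformity, le_inf_iff, LeftCauchy, map_neBot_iff, ← h]
  exact ⟨fun h => ⟨⟨h.1, tendsto_iff_comap.2 h.2.1⟩, h.1, h.2.2⟩,
    fun h => ⟨h.1.1, tendsto_iff_comap.1 h.1.2, h.2.2⟩⟩

theorem isCompleteGroup_iff :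
    IsCompleteGroup X ↔ ∀ F : Filter X, LeftCauchy F → LeftCauchy (map (·⁻¹) F) → ∃ x, F ≤ 𝓝 x := by
  have h1 : IsCompleteGroup X ↔ ∀ F : Filter X, @Cauchy X (twoSidedUniformSpace X) F →
      ∃ x, F ≤ @nhds X (twoSidedUniformSpace X).toTopologicalSpace x :=
    ⟨fun h F hF => h.complete hF, fun h => @CompleteSpace.mk X (twoSidedUniformSpace X) (h _)⟩
  have h2 : ∀ x : X, @nhds X (twoSidedUniformSpace X).toTopologicalSpace x = 𝓝 x := fun x =>
    congrArg (fun t : TopologicalSpace X => @nhds X t x) toTopologicalSpace_twoSidedUniformSpace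
  simp only [h1, cauchy_twoSidedUniformSpace_iff, and_imp]
  exact forall_congr' fun F => imp_congr_right fun _ => imp_congr_right fun _ =>
    exists_congr fun x => iff_of_eq (congrArg (F ≤ ·) (h2 x))

theorem IsWeilComplete.isCompleteGroup (h : IsWeilComplete X) : IsCompleteGroup X :=
  isCompleteGroup_iff.2 fun F hF _ => isWeilComplete_iff.1 h F hF

/-- In a group of compact exponent, the inverses along a left Cauchy filter are left Cauchy, as
`x⁻¹ = x ^ (n - 1) * (x ^ n)⁻¹`, and `x ^ n` converges. -/
theorem IsCompleteGroup.isWeilComplete (h : IsCompleteGroup X) (hX : HasCompactExponent X) :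
    IsWeilComplete X := by
  refine isWeilComplete_iff.2 fun F hF => isCompleteGroup_iff.1 h F hF ?_
  have := hF.1
  obtain ⟨n, hn, hK⟩ := hX
  obtain ⟨n, rfl⟩ : ∃ k, n = k + 1 := ⟨n - 1, by omega⟩
  obtain ⟨k, -, hk⟩ := hK (f := map (fun x => x ^ (n + 1)) F)
    (le_principal_iff.2 (mem_of_superset (range_mem_map) subset_closure))
  have hlim : map (fun x => x ^ (n + 1)) F ≤ 𝓝 k :=
    @le_nhds_of_cauchy_adhp X (IsTopologicalGroup.leftUniformSpace X) _ k
      (leftCauchy_iff_cauchy.1 (hF.map_pow (n + 1))) hk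
  have hinv : LeftCauchy (map (fun x => (x ^ (n + 1))⁻¹) F) :=
    leftCauchy_of_le_nhds (x := k⁻¹) (Tendsto.inv hlim)
  convert (hF.map_pow n).map_mul hinv using 2
  funext x
  rw [pow_succ', mul_inv_rev, mul_inv_cancel_left]

theorem LeftTotallyBounded.isCompact_closure (h : IsWeilComplete X) {A : Set X}
    (hA : LeftTotallyBounded A) : IsCompact (closure A) := by
  let := IsTopologicalGroup.leftUniformSpace X
  have : CompleteSpace X := h
  refine TotallyBounded.isCompact_of_isClosed (TotallyBounded.closure ?_) isClosed_closure
  rintro d ⟨U, hU, hUd⟩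
  obtain ⟨F, hF, hAF⟩ := hA U⁻¹ (inv_mem_nhds_one X hU)
  refine ⟨F, hF, fun x hx => ?_⟩
  obtain ⟨f, hf, u, hu, rfl⟩ := hAF hx
  refine mem_iUnion₂.2 ⟨f, hf, hUd ?_⟩
  simpa using hu

end LeftCauchy

/-- The completion of a topological group in its left uniformity is a topological semigroup. -/
theorem IsETSClosed.isWeilComplete {X : Type u} [TopologicalSpace X] [Group X]
    [IsTopologicalGroup X] [T2Space X] (h : IsETSClosed.{u, max u v} X) : IsWeilComplete X := by
  let := IsTopologicalGroup.leftUniformSpace X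
  let Y := UniformSpace.Completion X
  let e : X → Y := (↑)
  have he : IsDenseInducing e := UniformSpace.Completion.isDenseInducing_coe
  have hee := he.prodMap he
  let M : Y × Y → Y := hee.extend fun p => e (p.1 * p.2)
  have hlim : ∀ b : Y × Y, ∃ c, Tendsto (fun p : X × X => e (p.1 * p.2))
      (comap (Prod.map e e) (𝓝 b)) (𝓝 c) := by
    rintro ⟨y, z⟩
    have hC : ∀ y : Y, LeftCauchy (comap e (𝓝 y)) := fun y => by
      have := he.comap_nhds_neBot y
      exact leftCauchy_iff_cauchy.2 (cauchy_nhds.comap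
        (UniformSpace.Completion.comap_coe_eq_uniformity X).le)
    have := ((leftCauchy_iff_cauchy.1 ((hC y).mul (hC z))).map
      (UniformSpace.Completion.uniformContinuous_coe X))
    obtain ⟨c, hc⟩ := CompleteSpace.complete this
    refine ⟨c, ?_⟩
    rw [nhds_prod_eq, Filter.comap_prodMap_prod]
    rwa [Filter.map_map] at hc
  have hM : Continuous M := hee.continuous_extend hlim
  have hMe : ∀ x y : X, M (e x, e y) = e (x * y) := fun x y => hee.extend_eq' hlim (x, y)
  let : Semigroup Y :=
    { mul := fun y z => M (y, z)
      mul_assoc := fun x y z => by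
        change M (M (x, y), z) = M (x, M (y, z))
        refine UniformSpace.Completion.induction_on₃ x y z (isClosed_eq ?_ ?_) fun x y z => ?_
        · fun_prop
        · fun_prop
        · change M (M (e x, e y), e z) = M (e x, M (e y, e z))
          rw [hMe, hMe, hMe, hMe, mul_assoc] }
  have : ContinuousMul Y := ⟨hM⟩
  have hcl := h.isClosed_range (Y := Y) ⟨e, fun x y => (hMe x y).symm⟩
    ⟨he.isInducing, UniformSpace.Completion.coe_injective X⟩
  have hsurj : Function.Surjective e := range_eq_univ.1 (hcl.closure_eq ▸ he.dense.closure_range)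
  exact ((UniformSpace.Completion.isUniformInducing_coe X).completeSpace_congr
    hsurj).2 inferInstance

/-! ### Groups of compact exponent in powertopological semigroups -/

section Semigroup

theorem semigroupPow_succ' {S : Type*} [Semigroup S] (x : S) (n : ℕ) :
    semigroupPow x (n + 1) = x * semigroupPow x n := by
  induction n with
  | zero => rfl
  | succ n ih =>
    change semigroupPow x (n + 1) * x = x * (semigroupPow x n * x)
    rw [ih, mul_assoc]

theorem map_semigroupPow {S T : Type*} [Semigroup S] [Semigroup T] (f : S →ₙ* T) (x : S) (n : ℕ) :
    f (semigroupPow x n) = semigroupPow (f x) n := by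
  induction n with
  | zero => rfl
  | succ n ih => rw [semigroupPow, map_mul, ih, ← semigroupPow]

variable {X Y : Type*} [Group X] [TopologicalSpace Y] [Semigroup Y] [SeparatelyContinuousMul Y]

theorem mul_mem_closure_image_mul (f : X →ₙ* Y) {S T : Set X} {a b : Y} (ha : a ∈ closure (f '' S))
    (hb : b ∈ closure (f '' T)) : a * b ∈ closure (f '' (S * T)) := by
  rw [← closure_closure]
  refine map_mem_closure (f := fun y => y * b) (continuous_mul_const b) ha ?_
  rintro _ ⟨s, hs, rfl⟩
  refine map_mem_closure (continuous_const_mul (f s)) hb ?_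
  rintro _ ⟨t, ht, rfl⟩
  exact ⟨s * t, Set.mul_mem_mul hs ht, map_mul f s t⟩

theorem semigroupPow_mem_closure_image_pow (f : X →ₙ* Y) {S : Set X} {a : Y}
    (ha : a ∈ closure (f '' S)) (n : ℕ) : semigroupPow a n ∈ closure (f '' (S ^ (n + 1))) := by
  induction n with
  | zero => simpa [semigroupPow] using ha
  | succ n ih => rw [pow_succ]; exact mul_mem_closure_image_mul f ih ha

end Semigroup

theorem exists_nhds_one_pow_subset {X : Type*} [TopologicalSpace X] [Group X] [IsTopologicalGroup X]
    (n : ℕ) {U : Set X} (hU : U ∈ 𝓝 (1 : X)) : ∃ V ∈ 𝓝 (1 : X), V⁻¹ = V ∧ V ^ n ⊆ U := by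
  induction n generalizing U with
  | zero =>
    obtain ⟨V, hV, -, hVi, -⟩ := exists_closed_nhds_one_inv_eq_mul_subset hU
    exact ⟨V, hV, hVi, by simpa using mem_of_mem_nhds hU⟩
  | succ n ih =>
    obtain ⟨V, hV, -, hVi, hVU⟩ := exists_closed_nhds_one_inv_eq_mul_subset hU
    obtain ⟨W, hW, hWi, hWV⟩ := ih hV
    refine ⟨W ∩ V, inter_mem hW hV, by rw [Set.inter_inv, hWi, hVi], ?_⟩
    rw [pow_succ]
    exact (Set.mul_subset_mul ((Set.pow_subset_pow_left inter_subset_left).trans hWV)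
      inter_subset_right).trans hVU

/-- In a powertopological semigroup, every point `y` of the closure of a group of compact
exponent has a power in the group, hence is invertible. The inverses of the points near the unit are
expressed through their powers, so the trace on the group of the neighborhoods of `y` is left
Cauchy. -/
theorem IsWeilComplete.isEpTSClosed {X : Type u} [TopologicalSpace X] [Group X]
    [IsTopologicalGroup X] [T2Space X] (h : IsWeilComplete X) (hX : HasCompactExponent X) :
    IsEpTSClosed.{u, v} X := by
  intro Y _ _ _ _ f hf
  obtain ⟨n, hn, hK⟩ := hX
  obtain ⟨k, rfl⟩ : ∃ k, n = k + 1 := ⟨n - 1, by omega⟩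
  have hpow : ∀ y ∈ closure (range f), ∃ x, f x = semigroupPow y k := by
    have hcl : IsClosed (f '' closure (range fun x : X => x ^ (k + 1))) :=
      (hK.image hf.continuous).isClosed
    intro y hy
    have : semigroupPow y k ∈ f '' closure (range fun x : X => x ^ (k + 1)) := by
      rw [← hcl.closure_eq]
      refine map_mem_closure (f := fun y => semigroupPow y k)
        (IsPowertopologicalSemigroup.continuous_semigroupPow k) hy ?_
      rintro _ ⟨x, rfl⟩
      refine ⟨x ^ (k + 1), subset_closure ⟨x, rfl⟩, ?_⟩
      rw [← semigroupPow_eq_pow, map_semigroupPow]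
    obtain ⟨x, -, hx⟩ := this
    exact ⟨x, hx⟩
  have hone : ∀ y ∈ closure (range f), f 1 * y = y ∧ y * f 1 = y := by
    refine closure_minimal ?_ ((isClosed_eq (continuous_const_mul _) continuous_id).inter
      (isClosed_eq (continuous_mul_const _) continuous_id))
    rintro _ ⟨x, rfl⟩
    constructor <;> simp [← map_mul]
  have hmul : ∀ y ∈ closure (range f), ∀ z ∈ closure (range f), y * z ∈ closure (range f) := by
    intro y hy z hz
    rw [← image_univ] at *
    simpa using mul_mem_closure_image_mul f hy hz
  have hcancel : ∀ x : X, f x * f x⁻¹ = f 1 ∧ f x⁻¹ * f x = f 1 := fun x => by simp [← map_mul]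
  refine isClosed_of_closure_subset fun y hy => ?_
  rcases k with _ | j
  · exact hpow y hy
  obtain ⟨c, hc⟩ := hpow y hy
  have hcC : ∀ x : X, f x ∈ closure (range f) := fun x => subset_closure ⟨x, rfl⟩
  -- the inverse of `y`
  obtain ⟨z, hz, hzy, hyz⟩ : ∃ z ∈ closure (range f), z * y = f 1 ∧ y * z = f 1 := by
    have hp : semigroupPow y j ∈ closure (range f) := by
      have := semigroupPow_mem_closure_image_pow f (S := univ) (by rwa [image_univ]) j (a := y)
      exact closure_mono (image_subset_range _ _) this
    have hcomm : f c⁻¹ * y = y * f c⁻¹ := by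
      have h1 : y * f c = f c * y := by
        rw [hc, ← semigroupPow_succ', ← semigroupPow]
      calc f c⁻¹ * y = f c⁻¹ * (y * f c) * f c⁻¹ := by
            rw [mul_assoc, mul_assoc, (hcancel c).1, (hone y hy).2]
        _ = y * f c⁻¹ := by rw [h1, ← mul_assoc, (hcancel c).2, (hone y hy).1]
    refine ⟨f c⁻¹ * semigroupPow y j, hmul _ (hcC _) _ hp, ?_, ?_⟩
    · rw [mul_assoc, ← semigroupPow, ← hc, (hcancel c).2]
    · rw [← mul_assoc, ← hcomm, mul_assoc, ← semigroupPow_succ', ← hc, (hcancel c).2]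
  have hF : (comap f (𝓝 y)).NeBot := by
    simpa [mem_closure_iff_comap_neBot, comap_neBot_iff] using hy
  suffices hL : LeftCauchy (comap f (𝓝 y)) by
    obtain ⟨x, hx⟩ := isWeilComplete_iff.1 h _ hL
    exact ⟨x, tendsto_nhds_unique ((hf.continuous.tendsto x).mono_left hx) tendsto_comap⟩
  refine leftCauchy_iff.2 ⟨hF, fun U hU => ?_⟩
  obtain ⟨U', hU', hU'c, -, hU'U⟩ := exists_closed_nhds_one_inv_eq_mul_subset hU
  have hU'U : U' ⊆ U := fun x hx => hU'U ⟨x, hx, 1, mem_of_mem_nhds hU', mul_one x⟩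
  obtain ⟨V, hV, hVi, hVU⟩ := exists_nhds_one_pow_subset (j + 1 + (j + 1 + 1) + 1) hU'
  obtain ⟨O, hO, hO1, hOV⟩ : ∃ O : Set Y, IsOpen O ∧ f 1 ∈ O ∧ f ⁻¹' O ⊆ V := by
    rw [hf.nhds_eq_comap, mem_comap] at hV
    obtain ⟨t, ht, htV⟩ := hV
    obtain ⟨O, hOt, hO, hO1⟩ := mem_nhds_iff.1 ht
    exact ⟨O, hO, hO1, (preimage_mono hOt).trans htV⟩
  have hu : ∀ x, z * f x ∈ O → z * f x ∈ closure (f '' V) := fun x hx => by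
    refine closure_mono ?_ (hO.inter_closure ⟨hx, hmul z hz _ (hcC x)⟩)
    rintro _ ⟨ho, x, rfl⟩
    exact mem_image_of_mem f (hOV ho)
  refine ⟨f ⁻¹' ((z * ·) ⁻¹' O), preimage_mem_comap
    ((continuous_const_mul z).continuousAt.preimage_mem_nhds (hO.mem_nhds (by rwa [hzy]))), ?_⟩
  intro x hx x' hx'
  have hux := hu x hx
  obtain ⟨d, hd⟩ := hpow (z * f x) (hmul z hz _ (hcC x))
  have hdV : d ∈ closure (V ^ (j + 1 + 1)) := by
    rw [hf.isInducing.closure_eq_preimage_closure_image, mem_preimage, hd]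
    exact semigroupPow_mem_closure_image_pow f hux (j + 1)
  have hdV' : f d⁻¹ ∈ closure (f '' (V ^ (j + 1 + 1))) := by
    have h1 : d⁻¹ ∈ closure (V ^ (j + 1 + 1)) := by
      rw [← Set.mem_inv, inv_closure, ← inv_pow, hVi]
      exact hdV
    rwa [hf.isInducing.closure_eq_preimage_closure_image, mem_preimage] at h1
  -- `f x⁻¹ * y` is the inverse of `z * f x`
  have hinv : f x⁻¹ * y = semigroupPow (z * f x) j * f d⁻¹ := by
    have h1 : f x⁻¹ * y * (z * f x) = f 1 := by
      rw [mul_assoc, ← mul_assoc y, hyz, (hone _ (hcC x)).1, (hcancel x).2]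
    have h2 : f 1 * semigroupPow (z * f x) j = semigroupPow (z * f x) j :=
      (hone _ (closure_mono (image_subset_range _ _)
        (semigroupPow_mem_closure_image_pow f hux j))).1
    rw [← (hone _ (hmul _ (hcC x⁻¹) _ hy)).2, ← (hcancel d).1, hd, semigroupPow_succ',
      ← mul_assoc, ← mul_assoc, h1, h2]
  have hxx' : f (x⁻¹ * x') = semigroupPow (z * f x) j * f d⁻¹ * (z * f x') := by
    rw [← hinv, mul_assoc, ← mul_assoc y, hyz, (hone _ (hcC x')).1, map_mul]
  have hmem : f (x⁻¹ * x') ∈ closure (f '' (V ^ (j + 1 + (j + 1 + 1) + 1))) := by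
    rw [hxx', pow_succ V (j + 1 + (j + 1 + 1)), pow_add V (j + 1)]
    exact mul_mem_closure_image_mul f (mul_mem_closure_image_mul f
      (semigroupPow_mem_closure_image_pow f hux j) hdV') (hu x' hx')
  rw [← mem_preimage, ← hf.isInducing.closure_eq_preimage_closure_image] at hmem
  exact hU'U (closure_minimal hVU hU'c hmem)

theorem theorem4p5 (X : Type u) [TopologicalSpace X] [Group X] [IsTopologicalGroup X] [T2Space X]
    (hX : Group.IsNilpotent X) :
    List.TFAE
      [IsETSClosed.{u, max u v} X,
       IsEpTSClosed.{u, max u v} X,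
       IsWeilComplete X ∧ HasCompactExponent X,
       IsCompleteGroup X ∧ HasCompactExponent X] := by
  tfae_have 2 → 1 := by
    intro h Y _ _ _ _ f hf
    have : IsPowertopologicalSemigroup Y :=
      { continuous_semigroupPow := fun n => by
          induction n with
          | zero => exact continuous_id
          | succ n ih => exact ih.mul continuous_id }
    exact h Y f hf
  tfae_have 1 → 3 := fun h => by
    obtain ⟨n, hn, hnX⟩ := h.exists_leftTotallyBounded_range_pow X (MonoidHom.id X)
      continuous_id Function.surjective_id
    exact ⟨h.isWeilComplete, n, hn, hnX.isCompact_closure h.isWeilComplete⟩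
  tfae_have 3 → 4 := fun h => ⟨h.1.isCompleteGroup, h.2⟩
  tfae_have 4 → 3 := fun h => ⟨h.1.isWeilComplete h.2, h.2⟩
  tfae_have 3 → 2 := fun h => h.1.isEpTSClosed h.2
  tfae_finish
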